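/- **Definitions.** Let $\mathcal H_n=\{0,1\}^n$ with addition modulo 2, let $|x|$ be the Hamming weight of $x$, and let $U_n(x)=2^{-n}$. All logarithms are to the base 2. A code is a nonempty set $\mathcal C\subset\mathcal H_n$; its rate is $R(\mathcal C)=\frac1n\log|\mathcal C|$, and $f_{\mathcal C}=\mathbf 1_{\mathcal C}/|\mathcal C|$. For a probability mass function $r$ on $\mathcal H_n$ let $T_rf(x)=\sum_{z}r(z)f(x-z)$. For $\delta\in[0,1]$ let $\beta_\delta=\beta_\delta^{(n)}$ be the Bernoulli noise kernel $\beta_\delta(x)=\delta^{|x|}(1-\delta)^{n-|x|}$ on $\mathcal H_n$. For probability mass functions $P,Q$ on a finite set, with $Q$ strictly positive, the Rényi divergence is $$D_\alpha(P\|Q)=\begin{cases}-\log Q(\{i:P_i>0\}) & \alpha=0\\ \frac1{\alpha-1}\log\sum_iP_i^\alpha Q_i^{1-\alpha} & \alpha\in(0,1)\cup(1,\infty)\\ \sum_iP_i\log\frac{P_i}{Q_i} & \alpha=1\\ \max_i\log\frac{P_i}{Q_i} & \alpha=\infty.\end{cases}$$ For $\alpha\in[0,\infty]$ the $D_\alpha$-smoothing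 capacity of a sequence of kernels $r=(r_n)_n$ is $$S_\alpha^{r}=\inf_{(\mathcal C_n)_n}\Big\{\liminf_{n\to\infty}R(\mathcal C_n)\;:\;\lim_{n\to\infty}D_\alpha(T_{r_n}f_{\mathcal C_n}\|U_n)=0\Big\},$$ where the infimum is over sequences of codes $\mathcal C_n\subset\mathcal H_n$. Finally, let $h(\delta)=-\delta\log\delta-(1-\delta)\log(1-\delta)$ (with $0\log 0=0$), $h_\alpha(\delta)=\frac1{1-\alpha}\log\big(\delta^\alpha+(1-\delta)^\alpha\big)$ for $1<\alpha<\infty$, and $h_\infty(\delta)=-\log\max\{\delta,1-\delta\}$. **Theorem.** Let $\delta\in[0,1]$. The $D_\alpha$-smoothing capacity of Bernoulli$(\delta)$ noise is $$S_\alpha^{\beta_\delta}=\begin{cases}0 & \text{if }\alpha=0\text{ and }0<\delta<1,\\ 1-h(\delta) & \text{if }\alpha\in(0,1],\\ 1-h_\alpha(\delta) & \text{if }\alpha\in(1,\infty].\end{cases}$$ -/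

import Mathlib

open scoped ENNReal Topology

namespace Smoothing

noncomputable section

/-- The binary Hamming space of dimension `n`, with coordinatewise addition modulo 2. -/
abbrev HammingSpace (n : ℕ) : Type := Fin n → ZMod 2

/-- A code of length `n` is a nonempty subset of the Hamming space. -/
abbrev Code (n : ℕ) : Type := {C : Finset (HammingSpace n) // C.Nonempty}

/-- The rate of a code, `log₂ |C| / n`. -/
def rate {n : ℕ} (C : Code n) : ℝ := Real.logb 2 (C.1.card : ℝ) / (n : ℝ)

/-- The code distribution: the uniform probability mass function on the code `C`. -/
def codeDist {n : ℕ} (C : Code n) (x : HammingSpace n) : ℝ :=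
  if x ∈ C.1 then 1 / (C.1.card : ℝ) else 0

/-- The uniform probability mass function on the Hamming space. -/
def unif (n : ℕ) (_x : HammingSpace n) : ℝ := 1 / (2 : ℝ) ^ n

/-- The action `T_r f = r ∗ f` of the noise kernel `r` on the function `f`. -/
def noisy {n : ℕ} (r f : HammingSpace n → ℝ) (x : HammingSpace n) : ℝ :=
  ∑ z, r z * f (x - z)

/-- The Bernoulli noise kernel `δ ^ |x| * (1 - δ) ^ (n - |x|)`, where `|x|` is the Hamming weight
(which never exceeds `n`). -/
def bernoulliKernel (δ : ℝ) (n : ℕ) (x : HammingSpace n) : ℝ :=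
  δ ^ hammingNorm x * (1 - δ) ^ (n - hammingNorm x)

/-- Rényi divergence of order `α ∈ [0, ∞]`, to the base 2, of a probability mass function `P` from
a probability mass function `Q` on a finite set; here `Q` is strictly positive, so that all
divergences are finite. -/
def renyiDiv {ι : Type*} [Fintype ι] (α : ℝ≥0∞) (P Q : ι → ℝ) : ℝ :=
  open Classical in
  if α = 0 then - Real.logb 2 (∑ i with 0 < P i, Q i)
  else if α = 1 then ∑ i, P i * Real.logb 2 (P i / Q i)
  else if α = ∞ then Real.logb 2 (⨆ i, P i / Q i)
  else 1 / (α.toReal - 1) * Real.logb 2 (∑ i, P i ^ α.toReal * Q i ^ (-(α.toReal - 1)))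

/-- Shannon entropy to the base 2. -/
def shannonEntropy {ι : Type*} [Fintype ι] (P : ι → ℝ) : ℝ :=
  - ∑ i, P i * Real.logb 2 (P i)

/-- Rényi entropy of order `α ∈ [0, ∞]`, to the base 2. -/
def renyiEntropy {ι : Type*} [Fintype ι] (α : ℝ≥0∞) (P : ι → ℝ) : ℝ :=
  open Classical in
  if α = 0 then Real.logb 2 ((Finset.univ.filter fun i => 0 < P i).card : ℝ)
  else if α = 1 then shannonEntropy P
  else if α = ∞ then - Real.logb 2 (⨆ i, P i)
  else 1 / (1 - α.toReal) * Real.logb 2 (∑ i, P i ^ α.toReal)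

/-- The binary Shannon entropy `h(δ)`. -/
def binEntropy (δ : ℝ) : ℝ := shannonEntropy ![δ, 1 - δ]

/-- The binary Rényi entropy `h_α(δ)`. -/
def binRenyiEntropy (α : ℝ≥0∞) (δ : ℝ) : ℝ := renyiEntropy α ![δ, 1 - δ]

/-- The sequence of codes `C n` of length `n` is asymptotically perfectly `D_α`-smoothable with
respect to the noise kernels `r n`. -/
def PerfectlySmoothable (α : ℝ≥0∞) (r : ∀ n, HammingSpace n → ℝ) (C : ∀ n, Code n) : Prop :=
  Filter.Tendsto (fun n => renyiDiv α (noisy (r n) (codeDist (C n))) (unif n))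
    Filter.atTop (𝓝 0)

/-- The `D_α`-smoothing capacity: the infimum of `liminf R(C n)` over the sequences of codes that
are asymptotically perfectly `D_α`-smoothable. The infimum and the lower limit are taken in the
extended reals, where they always exist. -/
def smoothingCapacity (α : ℝ≥0∞) (r : ∀ n, HammingSpace n → ℝ) : EReal :=
  ⨅ (C : ∀ n, Code n) (_ : PerfectlySmoothable α r C),
    Filter.liminf (fun n => ((rate (C n) : ℝ) : EReal)) Filter.atTop

end

end Smoothing

/-! Converse: the noisy distribution is an average of `M = |C|` shifts of the kernel `β`. Since `t ^
a` is superadditive for `a > 1` and subadditive for `a < 1`, comparing its power sum with `M ^ (1 -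
a) * ∑ β ^ a` gives `D_a ≥ n (1 - h_a) - log M` in both ranges (`le_renyiDiv_noisy`). For `a = ∞`
one codeword at the peak of the kernel suffices. Dividing by `n` bounds the rate.

Achievability: split the space into `2 ^ k` blocks and draw one codeword uniformly from each. At
every point the density relative to uniform is then a sum of independent nonnegative variables with
total mean `1`. For finite `a > 1`, `expect_sum_rpow_add_one_le` lowers the order of a moment by
one, at the cost of the moments of the summands; these vanish exponentially once the rate exceeds `1
- h_a`, so the `a`-th moment is eventually at most any constant above `1`. For `a = ∞` exponential
moments bound all `2 ^ n` points at once (`exists_forall_sum_le`).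

Orders in `(0, 1]` follow by a limit. Monotonicity gives `S_1 ≤ 1 - h_a` for all `a > 1`, and `a ↓
1` yields the upper bound. The converse at a fixed `a < 1` is too weak, but divergences of orders
below `1` are comparable up to constants (`renyiDiv_le_mul_renyiDiv`), so the converse at any `b <
1` applies to order `a`, and `b ↑ 1` closes the gap. -/

namespace Smoothing

/-! ### Rényi divergences and comparisons between orders -/

section Divergence

variable {ι : Type*} [Fintype ι]

/-- The power sum `∑ P ^ a * Q ^ (1 - a)` that defines the Rényi divergence of order `a`. -/
noncomputable def renyiSum (a : ℝ) (P Q : ι → ℝ) : ℝ := ∑ i, P i ^ a * Q i ^ (-(a - 1))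

/-- `P` is a probability mass function. -/
structure IsPMF (P : ι → ℝ) : Prop where
  nonneg : ∀ i, 0 ≤ P i
  sum_eq_one : ∑ i, P i = 1

theorem IsPMF.exists_pos {P : ι → ℝ} (hP : IsPMF P) : ∃ i, 0 < P i := by
  by_contra! h
  have := Finset.sum_nonpos (fun i (_ : i ∈ Finset.univ) => h i)
  rw [hP.sum_eq_one] at this
  linarith

theorem renyiDiv_of_real {α : ℝ≥0∞} (h0 : α ≠ 0) (h1 : α ≠ 1) (ht : α ≠ ∞) (P Q : ι → ℝ) :
    renyiDiv α P Q = 1 / (α.toReal - 1) * Real.logb 2 (renyiSum α.toReal P Q) := by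
  simp only [renyiDiv, h0, h1, ht, if_false, renyiSum]

theorem renyiDiv_ofReal {a : ℝ} (h0 : 0 < a) (h1 : a ≠ 1) (P Q : ι → ℝ) :
    renyiDiv (ENNReal.ofReal a) P Q = 1 / (a - 1) * Real.logb 2 (renyiSum a P Q) := by
  rw [renyiDiv_of_real, ENNReal.toReal_ofReal h0.le]
  · simpa using h0
  · simpa using h1
  · exact ENNReal.ofReal_ne_top

theorem renyiDiv_one (P Q : ι → ℝ) : renyiDiv 1 P Q = ∑ i, P i * Real.logb 2 (P i / Q i) := by
  simp [renyiDiv]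

theorem renyiDiv_top (P Q : ι → ℝ) : renyiDiv ∞ P Q = Real.logb 2 (⨆ i, P i / Q i) := by
  simp [renyiDiv]

/-- Jensen for the logarithm, proved from `log t ≤ t - 1` at `t = r i / m`, so that `r` need only be
positive on the support of `P`. -/
theorem sum_mul_logb_le {P r : ι → ℝ} (hP : IsPMF P) (hr : ∀ i, 0 < P i → 0 < r i) :
    ∑ i, P i * Real.logb 2 (r i) ≤ Real.logb 2 (∑ i, P i * r i) := by
  have hnn : ∀ i, 0 ≤ P i * r i := by
    intro i
    rcases (hP.nonneg i).eq_or_lt with h | h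
    · simp [← h]
    · exact (mul_pos h (hr i h)).le
  set m := ∑ i, P i * r i with hm
  have hmpos : 0 < m := by
    obtain ⟨i, hi⟩ := hP.exists_pos
    exact Finset.sum_pos' (fun i _ => hnn i) ⟨i, Finset.mem_univ _, mul_pos hi (hr i hi)⟩
  have h2 : 0 < Real.log 2 := Real.log_pos (by norm_num)
  have key : ∀ i, P i * Real.log (r i) ≤ P i * Real.log m + (P i * r i / m - P i) := by
    intro i
    rcases (hP.nonneg i).eq_or_lt with h | h
    · simp [← h]
    · have := Real.log_le_sub_one_of_pos (div_pos (hr i h) hmpos)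
      rw [Real.log_div (hr i h).ne' hmpos.ne'] at this
      have := mul_le_mul_of_nonneg_left this h.le
      calc _ = P i * Real.log m + P i * (Real.log (r i) - Real.log m) := by ring
        _ ≤ P i * Real.log m + P i * (r i / m - 1) := by linarith
        _ = _ := by ring
  have hs := Finset.sum_le_sum (fun i (_ : i ∈ Finset.univ) => key i)
  rw [Finset.sum_add_distrib, Finset.sum_sub_distrib, ← Finset.sum_mul, ← Finset.sum_div, ← hm,
    hP.sum_eq_one, div_self hmpos.ne'] at hs
  simp only [Real.logb, ← mul_div_assoc, ← Finset.sum_div]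
  gcongr
  linarith

/-- The power sum as a mean under `P` of the density ratio; `renyiSum_eq'` is the mean under `Q`.
Positivity of `a` rules out `0 ^ 0 = 1` off the support. -/
theorem renyiSum_eq {a : ℝ} (ha : 0 < a) {P Q : ι → ℝ} (hP : ∀ i, 0 ≤ P i) (hQ : ∀ i, 0 < Q i) :
    renyiSum a P Q = ∑ i, P i * (P i / Q i) ^ (a - 1) := by
  refine Finset.sum_congr rfl fun i _ => ?_
  rcases (hP i).eq_or_lt with h | h
  · simp [← h, Real.zero_rpow ha.ne']
  · rw [Real.div_rpow h.le (hQ i).le, Real.rpow_neg (hQ i).le, Real.rpow_sub_one h.ne']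
    field_simp

theorem renyiSum_eq' {a : ℝ} {P Q : ι → ℝ} (hP : ∀ i, 0 ≤ P i) (hQ : ∀ i, 0 < Q i) :
    renyiSum a P Q = ∑ i, Q i * (P i / Q i) ^ a := by
  refine Finset.sum_congr rfl fun i _ => ?_
  have := Real.rpow_pos_of_pos (hQ i) a
  rw [Real.div_rpow (hP i) (hQ i).le, Real.rpow_neg (hQ i).le, Real.rpow_sub_one (hQ i).ne']
  field_simp

theorem renyiSum_pos (a : ℝ) {P Q : ι → ℝ} (hP : IsPMF P) (hQ : ∀ i, 0 < Q i) :
    0 < renyiSum a P Q := by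
  obtain ⟨i, hi⟩ := hP.exists_pos
  refine Finset.sum_pos' (fun i _ => mul_nonneg (Real.rpow_nonneg (hP.nonneg i) _)
    (Real.rpow_nonneg (hQ i).le _)) ⟨i, Finset.mem_univ _, ?_⟩
  exact mul_pos (Real.rpow_pos_of_pos hi _) (Real.rpow_pos_of_pos (hQ i) _)

/-- Jensen serves both sides of order `1`: dividing by `a - 1` gives opposite inequalities according
to its sign. -/
theorem mul_renyiDiv_one_le {a : ℝ} (ha : 0 < a) {P Q : ι → ℝ} (hP : IsPMF P)
    (hQ : ∀ i, 0 < Q i) : (a - 1) * renyiDiv 1 P Q ≤ Real.logb 2 (renyiSum a P Q) := by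
  rw [renyiSum_eq ha hP.nonneg hQ, renyiDiv_one, Finset.mul_sum]
  refine le_trans (le_of_eq (Finset.sum_congr rfl fun i _ => ?_))
    (sum_mul_logb_le (r := fun i => (P i / Q i) ^ (a - 1)) hP
      fun i hi => Real.rpow_pos_of_pos (div_pos hi (hQ i)) _)
  rcases (hP.nonneg i).eq_or_lt with h | h
  · simp [← h]
  · rw [Real.logb_rpow_eq_mul_logb_of_pos (div_pos h (hQ i))]
    ring

theorem renyiDiv_le_renyiDiv_one {a : ℝ} (h0 : 0 < a) (h1 : a < 1) {P Q : ι → ℝ} (hP : IsPMF P)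
    (hQ : ∀ i, 0 < Q i) : renyiDiv (ENNReal.ofReal a) P Q ≤ renyiDiv 1 P Q := by
  have h := mul_renyiDiv_one_le h0 hP hQ
  rw [renyiDiv_ofReal h0 h1.ne, one_div_mul_eq_div, div_le_iff_of_neg (by linarith)]
  linarith

theorem renyiDiv_one_le_renyiDiv {a : ℝ} (h1 : 1 < a) {P Q : ι → ℝ} (hP : IsPMF P)
    (hQ : ∀ i, 0 < Q i) : renyiDiv 1 P Q ≤ renyiDiv (ENNReal.ofReal a) P Q := by
  have h := mul_renyiDiv_one_le (by linarith) hP hQ (a := a)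
  rw [renyiDiv_ofReal (by linarith) h1.ne', one_div_mul_eq_div, le_div_iff₀ (by linarith)]
  linarith

theorem renyiDiv_nonneg_of_lt_one {a : ℝ} (h0 : 0 < a) (h1 : a < 1) {P Q : ι → ℝ} (hP : IsPMF P)
    (hQ : ∀ i, 0 < Q i) (hQ1 : ∑ i, Q i = 1) : 0 ≤ renyiDiv (ENNReal.ofReal a) P Q := by
  rw [renyiDiv_ofReal h0 h1.ne]
  refine mul_nonneg_of_nonpos_of_nonpos (by rw [one_div_nonpos]; linarith) ?_
  refine Real.logb_nonpos (by norm_num) (renyiSum_pos a hP hQ).le ?_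
  calc renyiSum a P Q ≤ ∑ i, (a * P i + (1 - a) * Q i) := by
        refine Finset.sum_le_sum fun i _ => ?_
        rw [neg_sub]
        exact Real.geom_mean_le_arith_mean2_weighted h0.le (by linarith) (hP.nonneg i) (hQ i).le
          (by ring)
    _ = 1 := by
        rw [Finset.sum_add_distrib, ← Finset.mul_sum, ← Finset.mul_sum, hP.sum_eq_one, hQ1]
        ring

theorem renyiDiv_one_nonneg {P Q : ι → ℝ} (hP : IsPMF P)
    (hQ : ∀ i, 0 < Q i) (hQ1 : ∑ i, Q i = 1) : 0 ≤ renyiDiv 1 P Q :=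
  (renyiDiv_nonneg_of_lt_one (a := 1 / 2) (by norm_num) (by norm_num) hP hQ hQ1).trans
    (renyiDiv_le_renyiDiv_one (by norm_num) (by norm_num) hP hQ)

theorem renyiDiv_top_nonneg {P Q : ι → ℝ} (hP : IsPMF P)
    (hQ : ∀ i, 0 < Q i) (hQ1 : ∑ i, Q i = 1) : 0 ≤ renyiDiv ∞ P Q := by
  rw [renyiDiv_top]
  refine Real.logb_nonneg (by norm_num) ?_
  by_contra! h
  have hlt : ∀ i, P i < Q i := fun i => by
    have := (le_ciSup (Set.finite_range fun i => P i / Q i).bddAbove i).trans_lt h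
    rwa [div_lt_one (hQ i)] at this
  obtain ⟨i, -⟩ := hP.exists_pos
  have := Finset.sum_lt_sum_of_nonempty ⟨i, Finset.mem_univ i⟩ fun i _ => hlt i
  rw [hP.sum_eq_one, hQ1] at this
  exact this.false

/-- For orders below `1`, all Rényi divergences are within constant factors of each other. -/
theorem renyiDiv_le_mul_renyiDiv {a b : ℝ} (h0 : 0 < a) (hab : a ≤ b) (h1 : b < 1) {P Q : ι → ℝ}
    (hP : IsPMF P) (hQ : ∀ i, 0 < Q i) (hQ1 : ∑ i, Q i = 1) :
    renyiDiv (ENNReal.ofReal b) P Q ≤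
      b * (1 - a) / (a * (1 - b)) * renyiDiv (ENNReal.ofReal a) P Q := by
  have hb : 0 < b := h0.trans_le hab
  -- Power mean inequality with weights `Q` and exponent `b / a ≥ 1`.
  have key : renyiSum a P Q ^ (b / a) ≤ renyiSum b P Q := by
    rw [renyiSum_eq' hP.nonneg hQ, renyiSum_eq' hP.nonneg hQ]
    refine (Real.rpow_arith_mean_le_arith_mean_rpow Finset.univ Q (fun i => (P i / Q i) ^ a)
      (fun i _ => (hQ i).le) hQ1 (fun i _ => Real.rpow_nonneg (div_nonneg (hP.nonneg i) (hQ i).le) _)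
      ((one_le_div h0).2 hab)).trans (le_of_eq (Finset.sum_congr rfl fun i _ => ?_))
    rw [← Real.rpow_mul (div_nonneg (hP.nonneg i) (hQ i).le), mul_div_cancel₀ _ h0.ne']
  have hl := Real.logb_le_logb_of_le (b := 2) (by norm_num)
    (Real.rpow_pos_of_pos (renyiSum_pos a hP hQ) _) key
  rw [Real.logb_rpow_eq_mul_logb_of_pos (renyiSum_pos a hP hQ)] at hl
  rw [renyiDiv_ofReal hb h1.ne, renyiDiv_ofReal h0 (hab.trans_lt h1).ne, one_div_mul_eq_div,
    div_le_iff_of_neg (by linarith)]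
  refine le_trans (le_of_eq ?_) hl
  have e1 : 1 - b ≠ 0 := by linarith
  have e2 : a - 1 ≠ 0 := by linarith
  have e3 : 1 - a ≠ 0 := by linarith
  rw [show b - 1 = -(1 - b) by ring, show a - 1 = -(1 - a) by ring]
  field_simp

end Divergence

/-! ### Noisy codes and the Bernoulli kernel -/

section Noise

theorem unif_pos (n : ℕ) (x : HammingSpace n) : 0 < unif n x := by
  unfold unif; positivity

theorem card_hammingSpace (n : ℕ) : Fintype.card (HammingSpace n) = 2 ^ n := by
  simp [ZMod.card]

theorem sum_unif (n : ℕ) : ∑ x, unif n x = 1 := by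
  simp only [unif, Finset.sum_const, Finset.card_univ, card_hammingSpace, nsmul_eq_mul]
  push_cast
  field_simp

theorem Code.card_pos {n : ℕ} (C : Code n) : (0 : ℝ) < C.1.card := by
  exact_mod_cast C.2.card_pos

theorem noisy_codeDist {n : ℕ} (r : HammingSpace n → ℝ) (C : Code n) (x : HammingSpace n) :
    noisy r (codeDist C) x = (∑ c ∈ C.1, r (x - c)) / C.1.card := by
  have : noisy r (codeDist C) x = ∑ c, r (x - c) * codeDist C c :=
    Fintype.sum_equiv (Equiv.subLeft x) _ _ fun z => by simp [Equiv.subLeft_apply]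
  rw [this]
  simp only [codeDist, mul_ite, mul_zero, Finset.sum_ite_mem, Finset.univ_inter, mul_one_div,
    Finset.sum_div]

theorem isPMF_noisy {n : ℕ} {r : HammingSpace n → ℝ} (hr : IsPMF r) (C : Code n) :
    IsPMF (noisy r (codeDist C)) where
  nonneg x := by
    rw [noisy_codeDist]
    exact div_nonneg (Finset.sum_nonneg fun _ _ => hr.nonneg _) C.card_pos.le
  sum_eq_one := by
    simp only [noisy_codeDist]
    rw [← Finset.sum_div, Finset.sum_comm]
    have : ∀ c, ∑ x, r (x - c) = 1 := fun c => by
      rw [← hr.sum_eq_one]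
      exact Fintype.sum_equiv (Equiv.subRight c) _ _ fun z => by simp
    simp only [this, Finset.sum_const, nsmul_eq_mul, mul_one]
    exact div_self C.card_pos.ne'

theorem bernoulliKernel_eq_prod (δ : ℝ) (n : ℕ) (x : HammingSpace n) :
    bernoulliKernel δ n x = ∏ i, if x i = 0 then 1 - δ else δ := by
  rw [Finset.prod_ite, Finset.prod_const, Finset.prod_const, mul_comm, bernoulliKernel]
  have h := Finset.card_filter_add_card_filter_not (s := (Finset.univ : Finset (Fin n)))
    (fun i => x i = 0)
  have e : hammingNorm x = (Finset.univ.filter fun i => ¬ x i = 0).card := rfl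
  rw [Finset.card_univ, Fintype.card_fin] at h
  rw [e]
  congr 2
  omega

theorem bernoulliKernel_nonneg {δ : ℝ} (h0 : 0 ≤ δ) (h1 : δ ≤ 1) (n : ℕ) (x : HammingSpace n) :
    0 ≤ bernoulliKernel δ n x :=
  mul_nonneg (pow_nonneg h0 _) (pow_nonneg (by linarith) _)

/-- The power sum `δ ^ a + (1 - δ) ^ a` of the Bernoulli distribution. -/
noncomputable def powSum (a δ : ℝ) : ℝ := δ ^ a + (1 - δ) ^ a

/-- The kernel is a product over coordinates, so its power sums factor. -/
theorem sum_bernoulliKernel_rpow {δ : ℝ} (h0 : 0 ≤ δ) (h1 : δ ≤ 1) (n : ℕ) (a : ℝ) :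
    ∑ x, bernoulliKernel δ n x ^ a = powSum a δ ^ n := by
  have h : powSum a δ = ∑ b : ZMod 2, (if b = 0 then 1 - δ else δ) ^ a := by
    have : (Finset.univ : Finset (ZMod 2)) = {0, 1} := rfl
    rw [this, Finset.sum_pair (by decide)]
    simp [powSum, add_comm]
  rw [h, Fintype.sum_pow]
  refine Finset.sum_congr rfl fun x _ => ?_
  rw [bernoulliKernel_eq_prod, Real.finsetProd_rpow]
  intro i _
  split_ifs <;> linarith

theorem isPMF_bernoulliKernel {δ : ℝ} (h0 : 0 ≤ δ) (h1 : δ ≤ 1) (n : ℕ) :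
    IsPMF (bernoulliKernel δ n) where
  nonneg := bernoulliKernel_nonneg h0 h1 n
  sum_eq_one := by simpa [powSum] using sum_bernoulliKernel_rpow h0 h1 n 1

theorem powSum_pos {δ : ℝ} (h0 : 0 ≤ δ) (h1 : δ ≤ 1) (a : ℝ) : 0 < powSum a δ := by
  rcases h0.eq_or_lt with h | h
  · subst h
    have := Real.rpow_nonneg le_rfl a
    simp only [powSum, sub_zero, Real.one_rpow]
    linarith
  · have := Real.rpow_pos_of_pos h a
    have := Real.rpow_nonneg (sub_nonneg.2 h1) a
    unfold powSum
    linarith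

theorem bernoulliKernel_le {δ : ℝ} (h0 : 0 ≤ δ) (h1 : δ ≤ 1) (n : ℕ) (x : HammingSpace n) :
    bernoulliKernel δ n x ≤ max δ (1 - δ) ^ n := by
  rw [bernoulliKernel_eq_prod]
  refine (Finset.prod_le_prod (g := fun _ => max δ (1 - δ)) ?_ ?_).trans (by simp)
  · intro i _
    split_ifs <;> linarith
  · intro i _
    split_ifs <;> simp

theorem exists_bernoulliKernel_eq (δ : ℝ) (n : ℕ) :
    ∃ x, bernoulliKernel δ n x = max δ (1 - δ) ^ n := by
  rcases max_choice δ (1 - δ) with h | h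
  · exact ⟨fun _ => 1, by simp [bernoulliKernel_eq_prod, h]⟩
  · exact ⟨fun _ => 0, by simp [bernoulliKernel_eq_prod, h]⟩

end Noise

/-! ### Super- and subadditivity of powers -/

section Superadditive

/-- Write `t ^ a = t * t ^ (a - 1)` and compare each `y i` with the total in the second factor; for
`a ≤ 1` the same comparison reverses. -/
theorem sum_rpow_le_rpow_sum {ι : Type*} (s : Finset ι) {y : ι → ℝ} (hy : ∀ i, 0 ≤ y i) {a : ℝ}
    (ha : 1 ≤ a) : ∑ i ∈ s, y i ^ a ≤ (∑ i ∈ s, y i) ^ a := by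
  have hS : 0 ≤ ∑ i ∈ s, y i := Finset.sum_nonneg fun i _ => hy i
  have e : ∀ t : ℝ, 0 ≤ t → t ^ a = t * t ^ (a - 1) := fun t ht => by
    rw [← Real.rpow_one_add' ht (by linarith)]; ring_nf
  rw [e _ hS, Finset.sum_mul]
  refine Finset.sum_le_sum fun i hi => ?_
  rw [e _ (hy i)]
  exact mul_le_mul_of_nonneg_left (Real.rpow_le_rpow (hy i)
    (Finset.single_le_sum (fun i _ => hy i) hi) (by linarith)) (hy i)

theorem rpow_sum_le_sum_rpow {ι : Type*} (s : Finset ι) {y : ι → ℝ} (hy : ∀ i, 0 ≤ y i) {a : ℝ}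
    (h0 : 0 < a) (h1 : a ≤ 1) : (∑ i ∈ s, y i) ^ a ≤ ∑ i ∈ s, y i ^ a := by
  have hS : 0 ≤ ∑ i ∈ s, y i := Finset.sum_nonneg fun i _ => hy i
  have e : ∀ t : ℝ, 0 ≤ t → t ^ a = t * t ^ (a - 1) := fun t ht => by
    rw [← Real.rpow_one_add' ht (by linarith)]; ring_nf
  rw [e _ hS, Finset.sum_mul]
  refine Finset.sum_le_sum fun i hi => ?_
  rcases (hy i).eq_or_lt with h | h
  · simp [← h, Real.zero_rpow h0.ne']
  rw [e _ (hy i)]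
  exact mul_le_mul_of_nonneg_left (Real.rpow_le_rpow_of_nonpos h
    (Finset.single_le_sum (fun i _ => hy i) hi) (by linarith)) (hy i)

end Superadditive

/-! ### Lower bounds on the rate -/

section Converse

variable {δ : ℝ}

theorem sum_sum_bernoulliKernel_rpow (h0 : 0 ≤ δ) (h1 : δ ≤ 1) {n : ℕ} (C : Code n) (a : ℝ) :
    ∑ x, ∑ c ∈ C.1, bernoulliKernel δ n (x - c) ^ a = C.1.card * powSum a δ ^ n := by
  rw [Finset.sum_comm]
  have : ∀ c, ∑ x, bernoulliKernel δ n (x - c) ^ a = powSum a δ ^ n := fun c => by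
    rw [← sum_bernoulliKernel_rpow h0 h1]
    exact Fintype.sum_equiv (Equiv.subRight c) _ _ fun z => by simp
  simp [this]

theorem renyiSum_unif {n : ℕ} (a : ℝ) (P : HammingSpace n → ℝ) :
    renyiSum a P (unif n) = (2 : ℝ) ^ (n * (a - 1)) * ∑ x, P x ^ a := by
  rw [renyiSum, Finset.mul_sum]
  refine Finset.sum_congr rfl fun x _ => ?_
  rw [mul_comm, unif, one_div, Real.inv_rpow (by positivity), Real.rpow_neg (by positivity), inv_inv,
    ← Real.rpow_natCast, ← Real.rpow_mul (by norm_num)]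

theorem logb_two_rpow_mul_div {n : ℕ} {M K a : ℝ} (hM : 0 < M) (hK : 0 < K) :
    Real.logb 2 ((2 : ℝ) ^ (n * (a - 1)) * (M * K ^ n / M ^ a)) =
      n * (a - 1) + (1 - a) * Real.logb 2 M + n * Real.logb 2 K := by
  have hp := Real.rpow_pos_of_pos hM a
  rw [Real.logb_mul (by positivity) (by positivity), Real.logb_rpow (by norm_num) (by norm_num),
    Real.logb_div (by positivity) (by positivity), Real.logb_mul (by positivity) (by positivity),
    Real.logb_rpow_eq_mul_logb_of_pos hM, Real.logb_pow]
  ring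

/-- The noise kernel is so concentrated that the number of codewords limits how close to uniform
the noisy code distribution can be. -/
theorem le_renyiDiv_noisy (h0 : 0 ≤ δ) (h1 : δ ≤ 1) {a : ℝ} (ha0 : 0 < a) (ha1 : a ≠ 1) {n : ℕ}
    (C : Code n) :
    n * (1 - 1 / (1 - a) * Real.logb 2 (powSum a δ)) - Real.logb 2 C.1.card ≤
      renyiDiv (ENNReal.ofReal a) (noisy (bernoulliKernel δ n) (codeDist C)) (unif n) := by
  have hP := isPMF_noisy (isPMF_bernoulliKernel h0 h1 n) C
  have hpos := renyiSum_pos a hP (unif_pos n)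
  have hM := C.card_pos
  have hMa := Real.rpow_pos_of_pos hM a
  have hK := powSum_pos h0 h1 a
  have hb := bernoulliKernel_nonneg h0 h1 n
  have e : ∑ x, noisy (bernoulliKernel δ n) (codeDist C) x ^ a =
      (∑ x, (∑ c ∈ C.1, bernoulliKernel δ n (x - c)) ^ a) / (C.1.card : ℝ) ^ a := by
    rw [Finset.sum_div]
    refine Finset.sum_congr rfl fun x _ => ?_
    rw [noisy_codeDist, Real.div_rpow (Finset.sum_nonneg fun _ _ => hb _) hM.le]
  have hl := logb_two_rpow_mul_div (n := n) (a := a) hM hK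
  rw [renyiDiv_ofReal ha0 ha1]
  have fin : n * (1 - 1 / (1 - a) * Real.logb 2 (powSum a δ)) - Real.logb 2 C.1.card =
      (n * (a - 1) + (1 - a) * Real.logb 2 C.1.card + n * Real.logb 2 (powSum a δ)) / (a - 1) := by
    have e2 : a - 1 ≠ 0 := sub_ne_zero.2 ha1
    rw [show 1 - a = -(a - 1) by ring]
    field_simp
    ring
  rw [fin, one_div_mul_eq_div, ← hl, ← sum_sum_bernoulliKernel_rpow h0 h1]
  -- Below order `1` the factor `1 / (a - 1)` is negative, so subadditivity there and
  -- superadditivity above yield the same lower bound.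
  rcases ha1.lt_or_gt with h | h
  · refine div_le_div_of_nonpos_of_le (by linarith) (Real.logb_le_logb_of_le (by norm_num) hpos ?_)
    rw [renyiSum_unif, e]
    gcongr
    exact rpow_sum_le_sum_rpow _ (fun c => hb _) ha0 h.le
  · refine div_le_div_of_nonneg_right (Real.logb_le_logb_of_le (by norm_num) ?_ ?_) (by linarith)
    · rw [sum_sum_bernoulliKernel_rpow h0 h1]
      positivity
    rw [renyiSum_unif, e]
    gcongr
    exact sum_rpow_le_rpow_sum _ (fun c => hb _) h.le

/-- The shift by one codeword `c` of a point `z` where the kernel peaks already has density at least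
the peak over `|C|`. -/
theorem le_renyiDiv_top_noisy (h0 : 0 ≤ δ) (h1 : δ ≤ 1) {n : ℕ} (C : Code n) :
    n * (1 + Real.logb 2 (max δ (1 - δ))) - Real.logb 2 C.1.card ≤
      renyiDiv ∞ (noisy (bernoulliKernel δ n) (codeDist C)) (unif n) := by
  have hM := C.card_pos
  have hb := bernoulliKernel_nonneg h0 h1 n
  have hm : 0 < max δ (1 - δ) := by
    by_contra! h
    have := max_le_iff.1 h
    linarith
  obtain ⟨z, hz⟩ := exists_bernoulliKernel_eq δ n
  obtain ⟨c, hc⟩ := C.2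
  rw [renyiDiv_top]
  have hle : max δ (1 - δ) ^ n / C.1.card / unif n (z + c) ≤
      ⨆ i, noisy (bernoulliKernel δ n) (codeDist C) i / unif n i := by
    refine le_trans ?_ (le_ciSup (Set.finite_range fun i =>
      noisy (bernoulliKernel δ n) (codeDist C) i / unif n i).bddAbove (z + c))
    have := unif_pos n (z + c)
    simp only [noisy_codeDist]
    gcongr
    rw [← hz]
    refine le_trans (by simp) (Finset.single_le_sum
      (f := fun d => bernoulliKernel δ n (z + c - d)) (fun _ _ => hb _) hc)
  refine le_trans (le_of_eq ?_) (Real.logb_le_logb_of_le (b := 2) (by norm_num)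
    (div_pos (by positivity) (unif_pos n _)) hle)
  unfold unif
  rw [Real.logb_div (by positivity) (by positivity), Real.logb_div (by positivity) (by positivity),
    Real.logb_pow, Real.logb_div (by positivity) (by positivity), Real.logb_pow]
  simp
  ring

theorem le_liminf_rate {α : ℝ≥0∞} {r : ∀ n, HammingSpace n → ℝ} {C : ∀ n, Code n} {H : ℝ}
    (hC : PerfectlySmoothable α r C)
    (h : ∀ n, n * H - Real.logb 2 (C n).1.card ≤
      renyiDiv α (noisy (r n) (codeDist (C n))) (unif n)) :
    (H : EReal) ≤ Filter.liminf (fun n => ((rate (C n) : ℝ) : EReal)) Filter.atTop := by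
  have h1 : Filter.Tendsto (fun n : ℕ => H - renyiDiv α (noisy (r n) (codeDist (C n))) (unif n) *
      (n : ℝ)⁻¹) Filter.atTop (𝓝 H) := by
    have := hC.mul tendsto_inv_atTop_nhds_zero_nat
    simpa using this.const_sub H
  rw [← ((continuous_coe_real_ereal.tendsto H).comp h1).liminf_eq]
  refine Filter.liminf_le_liminf ?_
  filter_upwards [Filter.eventually_gt_atTop 0] with n hn
  have hn' : (0 : ℝ) < n := by exact_mod_cast hn
  simp only [Function.comp_apply, EReal.coe_le_coe_iff, rate]
  rw [le_div_iff₀ hn', sub_mul, mul_assoc, inv_mul_cancel₀ hn'.ne']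
  linarith [h n]

theorem le_smoothingCapacity_of_real (h0 : 0 ≤ δ) (h1 : δ ≤ 1) {a : ℝ} (ha0 : 0 < a)
    (ha1 : a ≠ 1) :
    ((1 - 1 / (1 - a) * Real.logb 2 (powSum a δ) : ℝ) : EReal) ≤
      smoothingCapacity (ENNReal.ofReal a) (bernoulliKernel δ) :=
  le_iInf₂ fun C hC => le_liminf_rate hC fun n => le_renyiDiv_noisy h0 h1 ha0 ha1 (C n)

theorem le_smoothingCapacity_top (h0 : 0 ≤ δ) (h1 : δ ≤ 1) :
    ((1 + Real.logb 2 (max δ (1 - δ)) : ℝ) : EReal) ≤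
      smoothingCapacity ∞ (bernoulliKernel δ) :=
  le_iInf₂ fun C hC => le_liminf_rate hC fun n => le_renyiDiv_top_noisy h0 h1 (C n)

/-- A Rényi divergence that is bounded by a multiple of another one has no larger capacity. -/
theorem smoothingCapacity_mono {α β : ℝ≥0∞} {r : ∀ n, HammingSpace n → ℝ} (K : ℝ)
    (h0 : ∀ n (C : Code n), 0 ≤ renyiDiv α (noisy (r n) (codeDist C)) (unif n))
    (h : ∀ n (C : Code n), renyiDiv α (noisy (r n) (codeDist C)) (unif n) ≤
      K * renyiDiv β (noisy (r n) (codeDist C)) (unif n)) :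
    smoothingCapacity α r ≤ smoothingCapacity β r := by
  refine le_iInf₂ fun C hC => iInf₂_le C ?_
  refine squeeze_zero (fun n => h0 n (C n)) (fun n => h n (C n)) ?_
  simpa using hC.const_mul K

end Converse

open scoped BigOperators

/-! ### Moments of sums of independent variables -/

section IndependentSums

variable {A B : Type*} [Fintype A] [DecidableEq A] [Fintype B]

theorem expect_prod_apply (w : A → B → ℝ) :
    𝔼 g : A → B, ∏ u, w u (g u) = ∏ u, 𝔼 b, w u b := by
  classical
  simp only [Fintype.expect_eq_sum_div_card, Finset.prod_div_distrib]
  rw [Finset.prod_univ_sum, Fintype.piFinset_univ]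
  simp

variable [Nonempty B]

/-- Resampling one coordinate preserves the uniform law: exchanging `g u` with the fresh value is an
involution on pairs. -/
theorem expect_update (u : A) (G : (A → B) → ℝ) :
    𝔼 g, 𝔼 b, G (Function.update g u b) = 𝔼 g, G g := by
  classical
  have hinv : Function.Involutive
      (fun p : (A → B) × B => (Function.update p.1 u p.2, p.1 u)) := fun p => by simp
  have h : ∑ g : A → B, ∑ b, G (Function.update g u b) = Fintype.card B * ∑ g, G g := by
    rw [← Fintype.sum_prod_type' (f := fun (g : A → B) b => G (Function.update g u b)),
      Fintype.sum_equiv hinv.toPerm (fun p => G (Function.update p.1 u p.2)) (fun p => G p.1)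
        fun p => rfl,
      Fintype.sum_prod_type' (f := fun (g : A → B) (_ : B) => G g), Finset.mul_sum]
    simp
  have hB : (Fintype.card B : ℝ) ≠ 0 := by exact_mod_cast Fintype.card_ne_zero
  simp only [Fintype.expect_eq_sum_div_card]
  rw [← Finset.sum_div, h, mul_div_cancel_left₀ _ hB]

/-- If `F` does not depend on the value at `u`, it is independent of that value. -/
theorem expect_mul_of_update (u : A) (ψ : B → ℝ) {F : (A → B) → ℝ}
    (hF : ∀ g b, F (Function.update g u b) = F g) :
    𝔼 g : A → B, ψ (g u) * F g = (𝔼 b, ψ b) * 𝔼 g, F g := by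
  rw [← expect_update u]
  simp only [hF, Function.update_self, ← Finset.expect_mul, ← Finset.mul_expect]

theorem expect_apply_eq (u : A) (ψ : B → ℝ) : 𝔼 g : A → B, ψ (g u) = 𝔼 b, ψ b := by
  have := expect_mul_of_update u ψ (F := fun _ => 1) fun _ _ => rfl
  simpa only [mul_one, Fintype.expect_const] using this

theorem exists_le_of_expect_le {Ω : Type*} [Fintype Ω] [Nonempty Ω] {F : Ω → ℝ} {c : ℝ}
    (h : 𝔼 ω, F ω ≤ c) : ∃ ω, F ω ≤ c := by
  by_contra! hc
  rw [Fintype.expect_eq_sum_div_card, div_le_iff₀ (by exact_mod_cast Fintype.card_pos)] at h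
  have := Finset.sum_lt_sum_of_nonempty Finset.univ_nonempty fun ω (_ : ω ∈ Finset.univ) => hc ω
  simp only [Finset.sum_const, Finset.card_univ, nsmul_eq_mul] at this
  linarith

/-- Either `y ≤ κ s` or `s ≤ y / κ`. Small `κ` keeps the coefficient of `s ^ q` near `1`; the large
coefficient falls on `y ^ q`. -/
theorem add_rpow_le_of_pos {y s κ q : ℝ} (hy : 0 ≤ y) (hs : 0 ≤ s) (hκ : 0 < κ) (hq : 0 ≤ q) :
    (y + s) ^ q ≤ (1 + 1 / κ) ^ q * y ^ q + (1 + κ) ^ q * s ^ q := by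
  rw [← Real.mul_rpow (by positivity) hy, ← Real.mul_rpow (by positivity) hs]
  have p1 : 0 ≤ (1 + 1 / κ) * y := by positivity
  have p2 : 0 ≤ (1 + κ) * s := by positivity
  rcases le_total y (κ * s) with h | h
  · have := Real.rpow_le_rpow (by positivity) (show y + s ≤ (1 + κ) * s by linarith) hq
    linarith [Real.rpow_nonneg p1 q]
  · have hs' : s ≤ 1 / κ * y := by
      rw [one_div_mul_eq_div, le_div_iff₀ hκ]
      linarith
    have := Real.rpow_le_rpow (by positivity) (show y + s ≤ (1 + 1 / κ) * y by linarith) hq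
    linarith [Real.rpow_nonneg p2 q]

variable {φ : A → B → ℝ}

theorem expect_sum_apply (φ : A → B → ℝ) :
    𝔼 g : A → B, ∑ u, φ u (g u) = ∑ u, 𝔼 b, φ u b := by
  rw [Finset.expect_sum_comm]
  exact Finset.sum_congr rfl fun u _ => expect_apply_eq u (φ u)

/-- Weighted AM-GM puts `S ^ q` below its tangent `q S + (1 - q)`, whose mean is `1`. -/
theorem expect_sum_rpow_le_one (hφ : ∀ u b, 0 ≤ φ u b) (hmean : ∑ u, 𝔼 b, φ u b = 1) {q : ℝ}
    (h0 : 0 ≤ q) (h1 : q ≤ 1) : 𝔼 g : A → B, (∑ u, φ u (g u)) ^ q ≤ 1 := by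
  calc 𝔼 g : A → B, (∑ u, φ u (g u)) ^ q
      ≤ 𝔼 g : A → B, (q * (∑ u, φ u (g u)) + (1 - q)) := by
        refine Finset.expect_le_expect fun g _ => ?_
        have := Real.geom_mean_le_arith_mean2_weighted h0 (sub_nonneg.2 h1)
          (Finset.sum_nonneg fun u (_ : u ∈ Finset.univ) => hφ u (g u)) zero_le_one (by ring)
        simpa using this
    _ = 1 := by
        rw [Finset.expect_add_distrib, ← Finset.mul_expect, expect_sum_apply, hmean,
          Fintype.expect_const]
        ring

/-- A moment of a sum of independent nonnegative random variables is controlled by the moment of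
order one less and the moments of the summands. -/
theorem expect_sum_rpow_add_one_le (hφ : ∀ u b, 0 ≤ φ u b) (hmean : ∑ u, 𝔼 b, φ u b = 1)
    {q κ : ℝ} (hq : 0 ≤ q) (hκ : 0 < κ) :
    𝔼 g : A → B, (∑ u, φ u (g u)) ^ (q + 1) ≤
      (1 + 1 / κ) ^ q * ∑ u, 𝔼 b, φ u b ^ (q + 1) +
        (1 + κ) ^ q * 𝔼 g : A → B, (∑ u, φ u (g u)) ^ q := by
  set K := (1 + 1 / κ) ^ q
  set L := (1 + κ) ^ q with hL
  have hL0 : 0 ≤ L := by positivity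
  set R : A → (A → B) → ℝ := fun u g => (∑ v ∈ Finset.univ.erase u, φ v (g v)) with hR
  have hR0 : ∀ u g, 0 ≤ R u g := fun u g => Finset.sum_nonneg fun v _ => hφ v (g v)
  have hsplit : ∀ u g, φ u (g u) + R u g = ∑ u, φ u (g u) := fun u g =>
    Finset.add_sum_erase _ (fun v => φ v (g v)) (Finset.mem_univ u)
  have hupd : ∀ u (g : A → B) b, R u (Function.update g u b) = R u g := fun u g b =>
    Finset.sum_congr rfl fun v hv => by
      rw [Function.update_of_ne (Finset.ne_of_mem_erase hv)]
  have hpow : ∀ t : ℝ, 0 ≤ t → t ^ (q + 1) = t * t ^ q := fun t ht => by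
    rw [Real.rpow_add_one' ht (by linarith), mul_comm]
  -- Expand one factor of `S ^ (q + 1) = ∑ φ u * S ^ q` and split `S = φ u + R u`; the remainder `R
  -- u` is independent of the factor `φ u`.
  have hpt : ∀ g : A → B, (∑ u, φ u (g u)) ^ (q + 1) ≤
      ∑ u, (K * φ u (g u) ^ (q + 1) + L * (φ u (g u) * R u g ^ q)) := fun g => by
    rw [hpow _ (Finset.sum_nonneg fun u _ => hφ u (g u)), Finset.sum_mul]
    refine Finset.sum_le_sum fun u _ => ?_
    rw [← hsplit u g, hpow _ (hφ u _)]
    calc _ ≤ φ u (g u) * (K * φ u (g u) ^ q + L * R u g ^ q) :=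
          mul_le_mul_of_nonneg_left (add_rpow_le_of_pos (hφ u _) (hR0 u g) hκ hq) (hφ u _)
      _ = _ := by ring
  refine (Finset.expect_le_expect fun g _ => hpt g).trans ?_
  rw [Finset.expect_sum_comm, Finset.mul_sum]
  have hterm : ∀ u, 𝔼 g : A → B, (K * φ u (g u) ^ (q + 1) + L * (φ u (g u) * R u g ^ q)) ≤
      K * 𝔼 b, φ u b ^ (q + 1) +
        (𝔼 b, φ u b) * (L * 𝔼 g : A → B, (∑ u, φ u (g u)) ^ q) := fun u => by
    rw [Finset.expect_add_distrib, ← Finset.mul_expect, ← Finset.mul_expect,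
      expect_apply_eq u fun b => φ u b ^ (q + 1),
      expect_mul_of_update u (φ u) (F := fun g => R u g ^ q) fun g b => by rw [hupd]]
    have h1 : 𝔼 g : A → B, R u g ^ q ≤ 𝔼 g : A → B, (∑ u, φ u (g u)) ^ q :=
      Finset.expect_le_expect fun g _ => Real.rpow_le_rpow (hR0 u g)
        (by rw [← hsplit u g]; linarith [hφ u (g u)]) hq
    have h2 : 0 ≤ 𝔼 b, φ u b := Finset.expect_nonneg fun b _ => hφ u b
    have := mul_le_mul_of_nonneg_left (mul_le_mul_of_nonneg_left h1 h2) hL0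
    linarith
  refine (Finset.sum_le_sum fun u _ => hterm u).trans (le_of_eq ?_)
  rw [Finset.sum_add_distrib, ← Finset.sum_mul, hmean, one_mul]

/-- Chernoff argument: independence factors the exponential moment, and on `[0, 1]` the chord of
`exp (s t)` leaves only the means. -/
theorem expect_exp_sum_le (hφ : ∀ u b, 0 ≤ φ u b) (hmean : ∑ u, 𝔼 b, φ u b = 1) {m s : ℝ}
    (hm : 0 < m) (hφm : ∀ u b, φ u b ≤ m) :
    𝔼 g : A → B, Real.exp (s * (∑ u, φ u (g u) / m)) ≤ Real.exp ((Real.exp s - 1) / m) := by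
  have hexp : ∀ g : A → B, Real.exp (s * (∑ u, φ u (g u) / m)) =
      ∏ u, Real.exp (s * (φ u (g u) / m)) := fun g => by
    rw [Finset.mul_sum, Real.exp_sum]
  simp only [hexp]
  rw [expect_prod_apply fun u b => Real.exp (s * (φ u b / m))]
  have hconv : ∀ t : ℝ, 0 ≤ t → t ≤ 1 → Real.exp (s * t) ≤ t * (Real.exp s - 1) + 1 :=
    fun t h0 h1 => by
      have := convexOn_exp.2 (Set.mem_univ s) (Set.mem_univ 0) h0 (sub_nonneg.2 h1) (by ring)
      simp only [smul_eq_mul, mul_zero, add_zero, Real.exp_zero, mul_one] at this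
      rw [mul_comm]
      linarith
  calc ∏ u, 𝔼 b, Real.exp (s * (φ u b / m))
      ≤ ∏ u, Real.exp ((𝔼 b, φ u b) * ((Real.exp s - 1) / m)) := by
        refine Finset.prod_le_prod (fun u _ => Finset.expect_nonneg fun b _ =>
          (Real.exp_pos _).le) fun u _ => ?_
        refine le_trans ?_ (Real.add_one_le_exp _)
        calc 𝔼 b, Real.exp (s * (φ u b / m))
            ≤ 𝔼 b, (φ u b * ((Real.exp s - 1) / m) + 1) := by
              refine Finset.expect_le_expect fun b _ => (hconv _ (div_nonneg (hφ u b) hm.le)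
                ((div_le_one hm).2 (hφm u b))).trans (le_of_eq (by ring))
          _ = _ := by
              rw [Finset.expect_add_distrib, ← Finset.expect_mul, Fintype.expect_const]
    _ = _ := by
        rw [← Real.exp_sum, ← Finset.sum_mul, hmean, one_mul]

/-- Simultaneous upper deviation bound for sums of independent variables with values in `[0, m]`
and total mean `1`. -/
theorem exists_forall_sum_le {X : Type*} [Fintype X] [Nonempty X] {φ : X → A → B → ℝ}
    (hφ : ∀ x u b, 0 ≤ φ x u b) (hmean : ∀ x, ∑ u, 𝔼 b, φ x u b = 1) {m s : ℝ}
    (hm : 0 < m) (hφm : ∀ x u b, φ x u b ≤ m) (hs : 0 < s) :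
    ∃ g : A → B, ∀ x, ∑ u, φ x u (g u) ≤
      (Real.exp s - 1) / s + m * Real.log (Fintype.card X) / s := by
  have hX : (0 : ℝ) < Fintype.card X := by exact_mod_cast Fintype.card_pos
  have h : 𝔼 g : A → B, ∑ x, Real.exp (s * (∑ u, φ x u (g u) / m)) ≤
      Fintype.card X * Real.exp ((Real.exp s - 1) / m) := by
    rw [Finset.expect_sum_comm]
    refine (Finset.sum_le_sum fun x _ =>
      expect_exp_sum_le (s := s) (hφ x) (hmean x) hm (hφm x)).trans (le_of_eq ?_)
    simp
  obtain ⟨g, hg⟩ := exists_le_of_expect_le h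
  refine ⟨g, fun x => ?_⟩
  -- Each nonnegative term is at most the sum over `x`, which replaces a union bound.
  have h1 := (Finset.single_le_sum (f := fun x => Real.exp (s * (∑ u, φ x u (g u) / m)))
    (fun x _ => (Real.exp_pos _).le) (Finset.mem_univ x)).trans hg
  rw [← Real.exp_log hX, ← Real.exp_add, Real.exp_le_exp, ← Finset.sum_div] at h1
  rw [← add_div, le_div_iff₀ hs]
  have h2 := mul_le_mul_of_nonneg_right h1 hm.le
  rw [add_mul, div_mul_cancel₀ _ hm.ne', mul_assoc, div_mul_cancel₀ _ hm.ne'] at h2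
  linarith

end IndependentSums

/-! ### Asymptotics of moments -/

section Moments

variable {A B X : ℕ → Type} [∀ n, Fintype (A n)] [∀ n, DecidableEq (A n)] [∀ n, Fintype (B n)]
  [∀ n, Nonempty (B n)]

/-- Induction on an integer bound for the order, with base case `q ≤ 1`. The estimate is uniform in
`x`, so it can be averaged over the space afterwards. -/
theorem eventually_expect_sum_rpow_le {φ : ∀ n, X n → A n → B n → ℝ} {ζ : ℝ → ℕ → ℝ}
    (hφ : ∀ n x u b, 0 ≤ φ n x u b) (hmean : ∀ n x, ∑ u, 𝔼 b, φ n x u b = 1)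
    (hζ : ∀ r n x, ∑ u, 𝔼 b, φ n x u b ^ r ≤ ζ r n) (m : ℕ) :
    ∀ q : ℝ, 0 ≤ q → q ≤ m + 1 →
      (∀ r, 1 < r → r ≤ q → Filter.Tendsto (ζ r) Filter.atTop (𝓝 0)) →
      ∀ c : ℝ, 1 < c → ∀ᶠ n in Filter.atTop, ∀ x : X n,
        𝔼 g : A n → B n, (∑ u, φ n x u (g u)) ^ q ≤ c := by
  induction m with
  | zero =>
    intro q h0 h1 _ c hc
    refine Filter.Eventually.of_forall fun n x => ?_
    exact (expect_sum_rpow_le_one (hφ n x) (hmean n x) h0 (by simpa using h1)).trans hc.le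
  | succ m ih =>
    intro q h0 h1 hlim c hc
    rcases le_or_gt q (m + 1) with h | h
    · exact ih q h0 h hlim c hc
    have hm : (0 : ℝ) ≤ m := m.cast_nonneg
    obtain ⟨p, rfl⟩ : ∃ p, q = p + 1 := ⟨q - 1, by ring⟩
    have hp : 0 < p := by linarith
    push_cast at h1
    obtain ⟨d, hd1, hdc⟩ := exists_between hc
    -- `κ` is fixed before `n` grows: the large factor `(1 + 1 / κ) ^ p` multiplies `ζ`, which tends
    -- to `0`.
    have hκ : ∃ κ : ℝ, 0 < κ ∧ (1 + κ) ^ p * d < c := by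
      have hcont : ContinuousAt (fun κ : ℝ => (1 + κ) ^ p * d) 0 :=
        ((continuousAt_const.add continuousAt_id).rpow_const (Or.inr hp.le)).mul continuousAt_const
      have ht : Filter.Tendsto (fun κ : ℝ => (1 + κ) ^ p * d) (𝓝[>] 0) (𝓝 d) := by
        have := hcont.tendsto.mono_left (nhdsWithin_le_nhds (s := Set.Ioi 0))
        simpa using this
      obtain ⟨κ, h1, h2⟩ := ((ht.eventually_lt_const hdc).and self_mem_nhdsWithin).exists
      exact ⟨κ, h2, h1⟩
    obtain ⟨κ, hκ0, hκc⟩ := hκ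
    have hz := (((hlim (p + 1) (by linarith) le_rfl).const_mul ((1 + 1 / κ) ^ p)).add_const
      ((1 + κ) ^ p * d)).eventually_le_const (by simpa using hκc)
    filter_upwards [hz, ih p hp.le (by linarith) (fun r hr hr' => hlim r hr (by linarith)) d hd1]
      with n hn hn' x
    refine (expect_sum_rpow_add_one_le (hφ n x) (hmean n x) hp.le hκ0).trans (le_trans ?_ hn)
    have := hζ (p + 1) n x
    have := hn' x
    gcongr

end Moments

/-! ### Random codes with one word per block -/

section RandomCode

open scoped BigOperators

variable {δ : ℝ} {n k : ℕ}

/-- The code that picks one word from each of the `2 ^ k` blocks of a partition. -/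
noncomputable def sectionCode (e : HammingSpace n ≃ Fin (2 ^ k) × Fin (2 ^ (n - k)))
    (g : Fin (2 ^ k) → Fin (2 ^ (n - k))) : Code n :=
  ⟨Finset.univ.image fun u => e.symm (u, g u), Finset.univ_nonempty.image _⟩

theorem sectionCode_injective (e : HammingSpace n ≃ Fin (2 ^ k) × Fin (2 ^ (n - k)))
    (g : Fin (2 ^ k) → Fin (2 ^ (n - k))) : Function.Injective fun u => e.symm (u, g u) :=
  fun _ _ h => (Prod.ext_iff.1 (e.symm.injective h)).1

theorem card_sectionCode (e : HammingSpace n ≃ Fin (2 ^ k) × Fin (2 ^ (n - k)))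
    (g : Fin (2 ^ k) → Fin (2 ^ (n - k))) : (sectionCode e g).1.card = 2 ^ k := by
  rw [sectionCode, Finset.card_image_of_injective _ (sectionCode_injective e g)]
  simp

theorem rate_sectionCode (e : HammingSpace n ≃ Fin (2 ^ k) × Fin (2 ^ (n - k)))
    (g : Fin (2 ^ k) → Fin (2 ^ (n - k))) : rate (sectionCode e g) = k / n := by
  rw [rate, card_sectionCode]
  simp [Real.logb_pow]

/-- The normalized contribution to the noisy density at `x` of the word `b` of the block `u`. -/
noncomputable def blockDensity (δ : ℝ) (e : HammingSpace n ≃ Fin (2 ^ k) × Fin (2 ^ (n - k)))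
    (x : HammingSpace n) (u : Fin (2 ^ k)) (b : Fin (2 ^ (n - k))) : ℝ :=
  2 ^ (n - k) * bernoulliKernel δ n (x - e.symm (u, b))

theorem noisy_sectionCode_div_unif (hk : k ≤ n)
    (e : HammingSpace n ≃ Fin (2 ^ k) × Fin (2 ^ (n - k)))
    (g : Fin (2 ^ k) → Fin (2 ^ (n - k))) (x : HammingSpace n) :
    noisy (bernoulliKernel δ n) (codeDist (sectionCode e g)) x / unif n x =
      ∑ u, blockDensity δ e x u (g u) := by
  rw [noisy_codeDist, card_sectionCode, sectionCode,
    Finset.sum_image fun _ _ _ _ h => sectionCode_injective e g h]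
  simp only [blockDensity, unif]
  rw [← Finset.mul_sum, pow_sub₀ _ (by norm_num) hk]
  push_cast
  field_simp

/-- The pairs `(u, b)` run through the whole space once, so the sum is a full power sum of the
kernel, independent of `x`. -/
theorem sum_expect_blockDensity_rpow (h0 : 0 ≤ δ) (h1 : δ ≤ 1)
    (e : HammingSpace n ≃ Fin (2 ^ k) × Fin (2 ^ (n - k))) (r : ℝ) (x : HammingSpace n) :
    ∑ u, 𝔼 b, blockDensity δ e x u b ^ r = ((2 : ℝ) ^ (n - k)) ^ (r - 1) * powSum r δ ^ n := by
  have hN : (0 : ℝ) < 2 ^ (n - k) := by positivity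
  have : ∑ u, ∑ b, blockDensity δ e x u b ^ r =
      ((2 : ℝ) ^ (n - k)) ^ r * powSum r δ ^ n := by
    rw [← sum_bernoulliKernel_rpow h0 h1, Finset.mul_sum,
      ← Fintype.sum_prod_type' (f := fun u b => blockDensity δ e x u b ^ r)]
    refine Fintype.sum_equiv (e.symm.trans (Equiv.subLeft x)) _ _ fun p => ?_
    rw [blockDensity, Real.mul_rpow hN.le (bernoulliKernel_nonneg h0 h1 _ _)]
    rfl
  simp only [Fintype.expect_eq_sum_div_card]
  rw [← Finset.sum_div, this, Fintype.card_fin, Real.rpow_sub_one hN.ne']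
  push_cast
  ring

theorem blockDensity_nonneg (h0 : 0 ≤ δ) (h1 : δ ≤ 1)
    (e : HammingSpace n ≃ Fin (2 ^ k) × Fin (2 ^ (n - k))) (x : HammingSpace n) (u) (b) :
    0 ≤ blockDensity δ e x u b :=
  mul_nonneg (by positivity) (bernoulliKernel_nonneg h0 h1 _ _)

theorem sum_expect_blockDensity (h0 : 0 ≤ δ) (h1 : δ ≤ 1)
    (e : HammingSpace n ≃ Fin (2 ^ k) × Fin (2 ^ (n - k))) (x : HammingSpace n) :
    ∑ u, 𝔼 b, blockDensity δ e x u b = 1 := by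
  simpa [powSum] using sum_expect_blockDensity_rpow h0 h1 e 1 x

theorem nonempty_equiv (hk : k ≤ n) :
    Nonempty (HammingSpace n ≃ Fin (2 ^ k) × Fin (2 ^ (n - k))) := by
  refine Fintype.card_eq.1 ?_
  rw [card_hammingSpace, Fintype.card_prod, Fintype.card_fin, Fintype.card_fin, ← pow_add,
    Nat.add_sub_cancel' hk]

end RandomCode

/-! ### Existence of good codes -/

section Achievability

variable {δ : ℝ}

/-- For each `n` take a code of least divergence among those of rate at most `ρ n`. This single
sequence beats the codes found for every `c`, so no diagonal argument is needed. -/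
theorem smoothingCapacity_le {α : ℝ≥0∞} {r : ∀ n, HammingSpace n → ℝ} {ρ : ℕ → ℝ} {R : ℝ}
    (h0 : ∀ n (C : Code n), 0 ≤ renyiDiv α (noisy (r n) (codeDist C)) (unif n))
    (hρ : Filter.Tendsto ρ Filter.atTop (𝓝 R)) (hne : ∀ n, ∃ C : Code n, rate C ≤ ρ n)
    (h : ∀ c : ℝ, 0 < c → ∀ᶠ n in Filter.atTop, ∃ C : Code n, rate C ≤ ρ n ∧
      renyiDiv α (noisy (r n) (codeDist C)) (unif n) ≤ c) :
    smoothingCapacity α r ≤ R := by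
  have hmin : ∀ n, ∃ C : Code n, rate C ≤ ρ n ∧ ∀ C' : Code n, rate C' ≤ ρ n →
      renyiDiv α (noisy (r n) (codeDist C)) (unif n) ≤
        renyiDiv α (noisy (r n) (codeDist C')) (unif n) := fun n => by
    obtain ⟨C, hC, hC'⟩ := Set.exists_min_image {C : Code n | rate C ≤ ρ n}
      (fun C => renyiDiv α (noisy (r n) (codeDist C)) (unif n)) (Set.toFinite _) (hne n)
    exact ⟨C, hC, hC'⟩
  choose C hC hCmin using hmin
  refine (iInf₂_le C ?_).trans ?_
  · rw [PerfectlySmoothable, Metric.tendsto_atTop']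
    intro ε hε
    obtain ⟨N, hN⟩ := Filter.eventually_atTop.1 (h (ε / 2) (by linarith))
    refine ⟨N, fun n hn => ?_⟩
    obtain ⟨C', h1, h2⟩ := hN n hn.le
    rw [Real.dist_eq, sub_zero, abs_of_nonneg (h0 _ _)]
    linarith [hCmin n C' h1]
  · rw [← ((continuous_coe_real_ereal.tendsto R).comp hρ).liminf_eq]
    exact Filter.liminf_le_liminf (Filter.Eventually.of_forall fun n =>
      EReal.coe_le_coe_iff.2 (hC n))

theorem renyiDiv_nonneg_of_one_lt (h0 : 0 ≤ δ) (h1 : δ ≤ 1) {a : ℝ} (ha : 1 < a) (n : ℕ)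
    (C : Code n) :
    0 ≤ renyiDiv (ENNReal.ofReal a) (noisy (bernoulliKernel δ n) (codeDist C)) (unif n) :=
  have hP := isPMF_noisy (isPMF_bernoulliKernel h0 h1 n) C
  (renyiDiv_one_nonneg hP (unif_pos n) (sum_unif n)).trans
    (renyiDiv_one_le_renyiDiv ha hP (unif_pos n))

theorem ceil_mul_le {R : ℝ} (hR1 : R ≤ 1) (n : ℕ) : ⌈R * n⌉₊ ≤ n :=
  Nat.ceil_le.2 (mul_le_of_le_one_left n.cast_nonneg hR1)

/-- Reduction of achievability to finding good codes among the section codes of rate about `R`. -/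
theorem smoothingCapacity_le_of_sectionCode {α : ℝ≥0∞} {r : ∀ n, HammingSpace n → ℝ} {R : ℝ}
    (hR0 : 0 ≤ R)
    (h0 : ∀ n (C : Code n), 0 ≤ renyiDiv α (noisy (r n) (codeDist C)) (unif n))
    (e : ∀ n : ℕ, HammingSpace n ≃ Fin (2 ^ ⌈R * n⌉₊) × Fin (2 ^ (n - ⌈R * n⌉₊)))
    (h : ∀ c : ℝ, 1 < c → ∀ᶠ n in Filter.atTop, ∃ g,
      renyiDiv α (noisy (r n) (codeDist (sectionCode (e n) g))) (unif n) ≤ Real.logb 2 c) :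
    smoothingCapacity α r ≤ R := by
  refine smoothingCapacity_le h0 (ρ := fun n => (⌈R * n⌉₊ : ℝ) / n) ?_ ?_ ?_
  · exact (tendsto_nat_ceil_mul_div_atTop hR0).comp tendsto_natCast_atTop_atTop
  · exact fun n => ⟨sectionCode (e n) fun _ => 0, (rate_sectionCode _ _).le⟩
  · intro c hc
    filter_upwards [h (2 ^ c) (Real.one_lt_rpow (by norm_num) hc)] with n hn
    obtain ⟨g, hg⟩ := hn
    refine ⟨_, (rate_sectionCode (e n) g).le, hg.trans ?_⟩
    rw [Real.logb_rpow (by norm_num) (by norm_num)]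

theorem two_pow_sub_ceil_le (R : ℝ) (n : ℕ) (hk : ⌈R * n⌉₊ ≤ n) :
    (2 : ℝ) ^ (n - ⌈R * n⌉₊) ≤ ((2 : ℝ) ^ (1 - R)) ^ n := by
  rw [← Real.rpow_natCast, ← Real.rpow_natCast, ← Real.rpow_mul (by norm_num), Nat.cast_sub hk]
  refine Real.rpow_le_rpow_of_exponent_le (by norm_num) ?_
  linarith [Nat.le_ceil (R * n)]

/-- Monotonicity of Rényi entropy in the order: the power mean inequality for `δ ^ (r - 1)`, `(1 -
δ) ^ (r - 1)` with weights `δ`, `1 - δ`. -/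
theorem powSum_le_powSum_rpow (h0 : 0 ≤ δ) (h1 : δ ≤ 1) {r a : ℝ} (hr : 1 < r) (hra : r ≤ a) :
    powSum r δ ≤ powSum a δ ^ ((r - 1) / (a - 1)) := by
  have h1' : 0 ≤ 1 - δ := by linarith
  have e : ∀ s t : ℝ, 1 < s → 0 ≤ t → t ^ s = t * t ^ (s - 1) := fun s t hs ht => by
    rw [← Real.rpow_one_add' ht (by linarith)]; ring_nf
  have hpos := powSum_pos h0 h1
  have key := Real.rpow_arith_mean_le_arith_mean_rpow Finset.univ ![δ, 1 - δ]
    ![δ ^ (r - 1), (1 - δ) ^ (r - 1)] (by simp [Fin.forall_fin_two, h0, h1]) (by simp)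
    (by simp [Fin.forall_fin_two, Real.rpow_nonneg h0, Real.rpow_nonneg h1'])
    (p := (a - 1) / (r - 1)) ((one_le_div (by linarith)).2 (by linarith))
  simp only [Fin.sum_univ_two, Matrix.cons_val_zero, Matrix.cons_val_one] at key
  rw [← Real.rpow_mul h0, ← Real.rpow_mul h1', mul_div_cancel₀ _ (by linarith), ← e r δ hr h0,
    ← e r _ hr h1', ← e a δ (by linarith) h0, ← e a _ (by linarith) h1'] at key
  have := Real.rpow_le_rpow (Real.rpow_nonneg (hpos r).le _) key
    (show 0 ≤ (r - 1) / (a - 1) from div_nonneg (by linarith) (by linarith))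
  change (powSum r δ ^ _) ^ _ ≤ powSum a δ ^ _ at this
  rwa [← Real.rpow_mul (hpos r).le, div_mul_div_comm, mul_comm (a - 1), div_self, Real.rpow_one]
    at this
  exact mul_ne_zero (by linarith) (by linarith)

/-- The moment induction needs decay at every order in `(1, a]`; the rate condition at `a` alone
implies it. -/
theorem rate_base_lt_one (h0 : 0 ≤ δ) (h1 : δ ≤ 1) {a R : ℝ}
    (hR : 1 - 1 / (1 - a) * Real.logb 2 (powSum a δ) < R) {r : ℝ} (hr : 1 < r) (hra : r ≤ a) :
    ((2 : ℝ) ^ (1 - R)) ^ (r - 1) * powSum r δ < 1 := by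
  have hpos := powSum_pos h0 h1
  have ha : 0 < a - 1 := by linarith
  have hbase : ((2 : ℝ) ^ (1 - R)) ^ (a - 1) * powSum a δ < 1 := by
    rw [← Real.logb_neg_iff (b := 2) (by norm_num) (mul_pos (by positivity) (hpos a)),
      Real.logb_mul (by positivity) (hpos a).ne', ← Real.rpow_mul (by norm_num),
      Real.logb_rpow (by norm_num) (by norm_num)]
    rw [show 1 - a = -(a - 1) by ring, one_div_mul_eq_div, div_neg, sub_neg_eq_add] at hR
    have := mul_lt_mul_of_pos_right hR ha
    rw [add_mul, div_mul_cancel₀ _ ha.ne'] at this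
    linarith
  have h2 : (0 : ℝ) < (2 : ℝ) ^ (1 - R) := by positivity
  calc ((2 : ℝ) ^ (1 - R)) ^ (r - 1) * powSum r δ
      ≤ ((2 : ℝ) ^ (1 - R)) ^ (r - 1) * powSum a δ ^ ((r - 1) / (a - 1)) := by
        gcongr
        exact powSum_le_powSum_rpow h0 h1 hr hra
    _ = (((2 : ℝ) ^ (1 - R)) ^ (a - 1) * powSum a δ) ^ ((r - 1) / (a - 1)) := by
        rw [Real.mul_rpow (by positivity) (hpos a).le, ← Real.rpow_mul h2.le,
          mul_div_cancel₀ _ ha.ne']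
    _ < 1 := Real.rpow_lt_one (mul_nonneg (by positivity) (hpos a).le) hbase
        (div_pos (by linarith) ha)

theorem renyiSum_sectionCode {n k : ℕ} (h0 : 0 ≤ δ) (h1 : δ ≤ 1) (hk : k ≤ n)
    (e : HammingSpace n ≃ Fin (2 ^ k) × Fin (2 ^ (n - k))) (g) (a : ℝ) :
    renyiSum a (noisy (bernoulliKernel δ n) (codeDist (sectionCode e g))) (unif n) =
      ∑ x, unif n x * (∑ u, blockDensity δ e x u (g u)) ^ a := by
  rw [renyiSum_eq' (isPMF_noisy (isPMF_bernoulliKernel h0 h1 n) _).nonneg (unif_pos n)]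
  simp only [noisy_sectionCode_div_unif hk]

theorem smoothingCapacity_le_of_lt (h0 : 0 ≤ δ) (h1 : δ ≤ 1) {a R : ℝ} (ha : 1 < a)
    (hR : 1 - 1 / (1 - a) * Real.logb 2 (powSum a δ) < R) (hR0 : 0 ≤ R) (hR1 : R ≤ 1) :
    smoothingCapacity (ENNReal.ofReal a) (bernoulliKernel δ) ≤ R := by
  have e : ∀ n : ℕ, HammingSpace n ≃ Fin (2 ^ ⌈R * n⌉₊) × Fin (2 ^ (n - ⌈R * n⌉₊)) :=
    fun n => (nonempty_equiv (ceil_mul_le hR1 n)).some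
  refine smoothingCapacity_le_of_sectionCode hR0
    (fun n C => renyiDiv_nonneg_of_one_lt h0 h1 ha n C) e ?_
  intro c hc
  have hlim : ∀ r, 1 < r → r ≤ a → Filter.Tendsto
      (fun n : ℕ => ((2 : ℝ) ^ (n - ⌈R * n⌉₊)) ^ (r - 1) * powSum r δ ^ n) Filter.atTop (𝓝 0) := by
    intro r hr hra
    have hp := powSum_pos h0 h1 r
    refine squeeze_zero (fun n => mul_nonneg (by positivity) (pow_nonneg hp.le _)) (fun n => ?_)
      (tendsto_pow_atTop_nhds_zero_of_lt_one (mul_nonneg (by positivity) hp.le)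
        (rate_base_lt_one h0 h1 hR hr hra))
    rw [mul_pow]
    refine mul_le_mul_of_nonneg_right ?_ (pow_nonneg hp.le _)
    rw [Real.rpow_pow_comm (x := (2 : ℝ) ^ (1 - R)) (by positivity)]
    exact Real.rpow_le_rpow (by positivity) (two_pow_sub_ceil_le R n (ceil_mul_le hR1 n))
      (by linarith)
  -- A power sum of at most `c ^ (a - 1)` means a divergence of at most `log c`.
  have hc' : 1 < c ^ (a - 1) := Real.one_lt_rpow hc (by linarith)
  obtain ⟨m, hm⟩ := exists_nat_ge a
  have hev := eventually_expect_sum_rpow_le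
    (φ := fun (n : ℕ) (x : HammingSpace n) u b => blockDensity δ (e n) x u b)
    (ζ := fun r n => ((2 : ℝ) ^ (n - ⌈R * n⌉₊)) ^ (r - 1) * powSum r δ ^ n)
    (fun n x => blockDensity_nonneg h0 h1 (e n) x)
    (fun n x => sum_expect_blockDensity h0 h1 (e n) x)
    (fun r n x => (sum_expect_blockDensity_rpow h0 h1 (e n) r x).le)
    m a (by linarith) (by linarith) hlim _ hc'
  filter_upwards [hev] with n hn
  have hk := ceil_mul_le hR1 n
  obtain ⟨g, hg⟩ : ∃ g, renyiSum a
      (noisy (bernoulliKernel δ n) (codeDist (sectionCode (e n) g))) (unif n) ≤ c ^ (a - 1) := by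
    refine exists_le_of_expect_le ?_
    simp only [renyiSum_sectionCode h0 h1 hk]
    rw [Finset.expect_sum_comm]
    calc _ ≤ ∑ x, unif n x * c ^ (a - 1) := by
          refine Finset.sum_le_sum fun x _ => ?_
          rw [← Finset.mul_expect]
          exact mul_le_mul_of_nonneg_left (hn x) (unif_pos n x).le
      _ = _ := by rw [← Finset.sum_mul, sum_unif, one_mul]
  refine ⟨g, ?_⟩
  have hP := isPMF_noisy (isPMF_bernoulliKernel h0 h1 n) (sectionCode (e n) g)
  rw [renyiDiv_ofReal (by linarith) ha.ne', one_div_mul_eq_div, div_le_iff₀ (by linarith)]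
  refine (Real.logb_le_logb_of_le (by norm_num) (renyiSum_pos a hP (unif_pos n)) hg).trans ?_
  rw [Real.logb_rpow_eq_mul_logb_of_pos (by linarith), mul_comm]

theorem smoothingCapacity_top_le_of_lt (h0 : 0 ≤ δ) (h1 : δ ≤ 1) {R : ℝ}
    (hR : 1 + Real.logb 2 (max δ (1 - δ)) < R) (hR0 : 0 ≤ R) (hR1 : R ≤ 1) :
    smoothingCapacity ∞ (bernoulliKernel δ) ≤ R := by
  have e : ∀ n : ℕ, HammingSpace n ≃ Fin (2 ^ ⌈R * n⌉₊) × Fin (2 ^ (n - ⌈R * n⌉₊)) :=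
    fun n => (nonempty_equiv (ceil_mul_le hR1 n)).some
  refine smoothingCapacity_le_of_sectionCode hR0
    (fun n C => renyiDiv_top_nonneg (isPMF_noisy (isPMF_bernoulliKernel h0 h1 n) C) (unif_pos n)
      (sum_unif n)) e ?_
  intro c hc
  have hmax : 0 < max δ (1 - δ) := by
    by_contra! h
    have := max_le_iff.1 h
    linarith
  set θ := (2 : ℝ) ^ (1 - R) * max δ (1 - δ) with hθ
  have hθ0 : 0 < θ := by positivity
  have hθ1 : θ < 1 := by
    rw [← Real.logb_neg_iff (b := 2) (by norm_num) hθ0, hθ,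
      Real.logb_mul (by positivity) hmax.ne', Real.logb_rpow (by norm_num) (by norm_num)]
    linarith
  -- `exp` has slope `1` at `0`, so a small `s` puts the main term of the deviation bound below `c`.
  obtain ⟨s, hs, hsc⟩ : ∃ s : ℝ, 0 < s ∧ (Real.exp s - 1) / s < c := by
    have hd := (Real.hasDerivAt_exp 0).tendsto_slope_zero_right
    simp only [zero_add, Real.exp_zero, smul_eq_mul] at hd
    obtain ⟨s, h1, h2⟩ := ((hd.eventually_lt_const hc).and self_mem_nhdsWithin).exists
    exact ⟨s, h2, by rwa [inv_mul_eq_div] at h1⟩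
  -- Controlling all `2 ^ n` points costs a factor `n log 2`, which the decay of `θ ^ n` absorbs.
  have hlim : Filter.Tendsto (fun n : ℕ => (Real.exp s - 1) / s +
      (n * θ ^ n) * (Real.log 2 / s)) Filter.atTop (𝓝 ((Real.exp s - 1) / s)) := by
    simpa using ((tendsto_self_mul_const_pow_of_lt_one hθ0.le hθ1).mul_const
      (Real.log 2 / s)).const_add ((Real.exp s - 1) / s)
  filter_upwards [hlim.eventually_le_const hsc] with n hn
  have hk := ceil_mul_le hR1 n
  have hle : ∀ x u b, blockDensity δ (e n) x u b ≤ θ ^ n := fun x u b => by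
    rw [hθ, mul_pow]
    exact mul_le_mul (two_pow_sub_ceil_le R n hk) (bernoulliKernel_le h0 h1 _ _)
      (bernoulliKernel_nonneg h0 h1 _ _) (by positivity)
  obtain ⟨g, hg⟩ := exists_forall_sum_le (fun x => blockDensity_nonneg h0 h1 (e n) x)
    (sum_expect_blockDensity h0 h1 (e n)) (pow_pos hθ0 n) hle hs
  refine ⟨g, ?_⟩
  have hP := isPMF_noisy (isPMF_bernoulliKernel h0 h1 n) (sectionCode (e n) g)
  rw [renyiDiv_top]
  refine Real.logb_le_logb_of_le (by norm_num) ?_ (ciSup_le fun x => ?_)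
  · obtain ⟨x, hx⟩ := hP.exists_pos
    exact (div_pos hx (unif_pos n x)).trans_le (le_ciSup (Set.finite_range fun i =>
      noisy (bernoulliKernel δ n) (codeDist (sectionCode (e n) g)) i / unif n i).bddAbove x)
  · rw [noisy_sectionCode_div_unif hk]
    refine (hg x).trans (le_trans (le_of_eq ?_) hn)
    rw [card_hammingSpace]
    push_cast
    rw [Real.log_pow]
    ring

end Achievability

/-! ### Values of the capacity -/

section Capacity

variable {δ : ℝ}

theorem noisy_univ {n : ℕ} {r : HammingSpace n → ℝ} (hr : IsPMF r) :
    noisy r (codeDist ⟨Finset.univ, Finset.univ_nonempty⟩) = unif n := by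
  funext x
  have : ∑ c, r (x - c) = 1 := by
    rw [← hr.sum_eq_one]
    exact Fintype.sum_equiv (Equiv.subLeft x) _ _ fun c => by simp
  rw [noisy_codeDist]
  simp only [this, Finset.card_univ, card_hammingSpace, unif]
  push_cast
  rfl

theorem rate_le_one {n : ℕ} (C : Code n) : rate C ≤ 1 := by
  refine div_le_one_of_le₀ ?_ n.cast_nonneg
  rw [Real.logb_le_iff_le_rpow (by norm_num) C.card_pos, Real.rpow_natCast]
  exact_mod_cast card_hammingSpace n ▸ Finset.card_le_univ C.1

/-- The whole space is perfectly smooth. This covers `R > 1`, where the block construction is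
unavailable. -/
theorem smoothingCapacity_le_one {α : ℝ≥0∞} {r : ∀ n, HammingSpace n → ℝ}
    (hr : ∀ n, IsPMF (r n)) (hα : ∀ n, renyiDiv α (unif n) (unif n) = 0) :
    smoothingCapacity α r ≤ 1 := by
  refine (iInf₂_le (fun n => ⟨Finset.univ, Finset.univ_nonempty⟩) ?_).trans ?_
  · simp only [PerfectlySmoothable, noisy_univ (hr _), hα]
    exact tendsto_const_nhds
  · refine Filter.liminf_le_of_le (by isBoundedDefault) fun b hb => ?_
    obtain ⟨n, hn⟩ := hb.exists
    exact hn.trans (by exact_mod_cast rate_le_one _)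

theorem renyiDiv_unif_self {a : ℝ} (h0 : 0 < a) (h1 : a ≠ 1) (n : ℕ) :
    renyiDiv (ENNReal.ofReal a) (unif n) (unif n) = 0 := by
  have : renyiSum a (unif n) (unif n) = 1 := by
    rw [renyiSum_eq' (fun x => (unif_pos n x).le) (unif_pos n), ← sum_unif n]
    exact Finset.sum_congr rfl fun x _ => by rw [div_self (unif_pos n x).ne']; simp
  rw [renyiDiv_ofReal h0 h1, this]
  simp

theorem renyiDiv_top_unif_self (n : ℕ) : renyiDiv ∞ (unif n) (unif n) = 0 := by
  rw [renyiDiv_top]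
  simp [div_self (unif_pos n _).ne']

/-- A quantity at most `1` and at most every `R ∈ (H, 1]` is at most `H`. -/
theorem le_coe_of_forall_lt {c : EReal} {H : ℝ} (hH : 0 ≤ H) (h1 : c ≤ 1)
    (h : ∀ R : ℝ, H < R → 0 ≤ R → R ≤ 1 → c ≤ R) : c ≤ H := by
  refine EReal.le_of_forall_lt_iff_le.1 fun R hR => ?_
  have hR' : H < R := EReal.coe_lt_coe_iff.1 hR
  rcases le_total R 1 with hR1 | hR1
  · exact h R hR' (hH.trans hR'.le) hR1
  · exact h1.trans (by exact_mod_cast hR1)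

theorem smoothingCapacity_of_one_lt (h0 : 0 ≤ δ) (h1 : δ ≤ 1) {a : ℝ} (ha : 1 < a) :
    smoothingCapacity (ENNReal.ofReal a) (bernoulliKernel δ) =
      ((1 - 1 / (1 - a) * Real.logb 2 (powSum a δ) : ℝ) : EReal) := by
  refine le_antisymm (le_coe_of_forall_lt ?_ (smoothingCapacity_le_one
    (isPMF_bernoulliKernel h0 h1) (renyiDiv_unif_self (by linarith) ha.ne'))
    fun R hR hR0 hR1 => smoothingCapacity_le_of_lt h0 h1 ha hR hR0 hR1)
    (le_smoothingCapacity_of_real h0 h1 (by linarith) ha.ne')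
  -- Convexity gives `h_a ≤ 1`, so the claimed capacity is nonnegative.
  have h : (δ + (1 - δ)) ^ a ≤ 2 ^ (a - 1) * (δ ^ a + (1 - δ) ^ a) := by
    exact_mod_cast NNReal.rpow_add_le_mul_rpow_add_rpow ⟨δ, h0⟩ ⟨1 - δ, sub_nonneg.2 h1⟩ ha.le
  rw [add_sub_cancel, Real.one_rpow] at h
  have hl := Real.logb_nonneg (b := 2) (by norm_num) h
  change 0 ≤ Real.logb 2 (2 ^ (a - 1) * powSum a δ) at hl
  rw [Real.logb_mul (by positivity) (powSum_pos h0 h1 a).ne',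
    Real.logb_rpow (by norm_num) (by norm_num)] at hl
  have ha' : 0 < a - 1 := by linarith
  rw [show 1 - a = -(a - 1) by ring, one_div_mul_eq_div, div_neg, sub_neg_eq_add]
  have := div_nonneg hl ha'.le
  rwa [add_div, div_self ha'.ne'] at this

theorem smoothingCapacity_top (h0 : 0 ≤ δ) (h1 : δ ≤ 1) :
    smoothingCapacity ∞ (bernoulliKernel δ) =
      ((1 + Real.logb 2 (max δ (1 - δ)) : ℝ) : EReal) := by
  refine le_antisymm (le_coe_of_forall_lt ?_ (smoothingCapacity_le_one
    (isPMF_bernoulliKernel h0 h1) renyiDiv_top_unif_self)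
    fun R hR hR0 hR1 => smoothingCapacity_top_le_of_lt h0 h1 hR hR0 hR1)
    (le_smoothingCapacity_top h0 h1)
  have hm : 1 / 2 ≤ max δ (1 - δ) := by
    rcases le_total δ (1 / 2) with h | h
    · exact le_max_of_le_right (by linarith)
    · exact le_max_of_le_left h
  have := Real.logb_le_logb_of_le (b := 2) (by norm_num) (by norm_num) hm
  have e : Real.logb 2 (1 / 2) = -1 := by
    rw [one_div, Real.logb_inv, Real.logb_self_eq_one (by norm_num)]
  linarith

/-- At `t = 0` the function vanishes near `a = 1`, in agreement with `0 log 0 = 0`; hence the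
endpoints of `δ` need no separate treatment. -/
theorem hasDerivAt_const_rpow_one {t : ℝ} (ht : 0 ≤ t) :
    HasDerivAt (fun a : ℝ => t ^ a) (t * Real.log t) 1 := by
  rcases ht.eq_or_lt with h | h
  · subst h
    rw [zero_mul]
    refine (hasDerivAt_const (1 : ℝ) (0 : ℝ)).congr_of_eventuallyEq ?_
    filter_upwards [lt_mem_nhds (zero_lt_one (α := ℝ))] with a ha
    exact Real.zero_rpow ha.ne'
  · simpa using (Real.hasStrictDerivAt_const_rpow h 1).hasDerivAt

theorem binEntropy_eq (δ : ℝ) :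
    binEntropy δ = -((δ * Real.log δ + (1 - δ) * Real.log (1 - δ)) / Real.log 2) := by
  simp only [binEntropy, shannonEntropy, Fin.sum_univ_two, Matrix.cons_val_zero,
    Matrix.cons_val_one, Real.logb]
  ring

/-- The binary Rényi entropy tends to the binary Shannon entropy as the order tends to `1`. -/
theorem tendsto_renyi_entropy (h0 : 0 ≤ δ) (h1 : δ ≤ 1) :
    Filter.Tendsto (fun a => 1 / (1 - a) * Real.logb 2 (powSum a δ)) (𝓝[≠] 1)
      (𝓝 (binEntropy δ)) := by
  have hs : powSum 1 δ = 1 := by simp [powSum]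
  have hd : HasDerivAt (fun a => Real.log (powSum a δ) / Real.log 2)
      ((δ * Real.log δ + (1 - δ) * Real.log (1 - δ)) / powSum 1 δ / Real.log 2) 1 :=
    (((hasDerivAt_const_rpow_one h0).add (hasDerivAt_const_rpow_one (sub_nonneg.2 h1))).log
      (powSum_pos h0 h1 1).ne').div_const _
  -- As `powSum 1 δ = 1`, the entropy is minus a difference quotient of `log (powSum a δ)` at `1`.
  have ht := hd.tendsto_slope.neg
  rw [hs, div_one, ← binEntropy_eq] at ht
  refine ht.congr fun a => ?_
  rw [slope_def_field, hs, Real.log_one, zero_div, sub_zero, Real.logb, ← neg_sub a 1,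
    one_div_mul_eq_div, div_neg]

theorem smoothingCapacity_of_le_one (h0 : 0 ≤ δ) (h1 : δ ≤ 1) {α : ℝ≥0∞} (hα0 : 0 < α)
    (hα1 : α ≤ 1) :
    smoothingCapacity α (bernoulliKernel δ) = ((1 - binEntropy δ : ℝ) : EReal) := by
  have hP : ∀ n (C : Code n), IsPMF (noisy (bernoulliKernel δ n) (codeDist C)) :=
    fun n C => isPMF_noisy (isPMF_bernoulliKernel h0 h1 n) C
  have hlim : Filter.Tendsto
      (fun a => ((1 - 1 / (1 - a) * Real.logb 2 (powSum a δ) : ℝ) : EReal)) (𝓝[≠] 1)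
      (𝓝 ((1 - binEntropy δ : ℝ) : EReal)) :=
    (continuous_coe_real_ereal.tendsto _).comp ((tendsto_renyi_entropy h0 h1).const_sub 1)
  have hsub : ∀ a : ℝ, 0 < a → a < 1 → smoothingCapacity (ENNReal.ofReal a) (bernoulliKernel δ) ≤
      smoothingCapacity 1 (bernoulliKernel δ) := fun a ha0 ha1 =>
    smoothingCapacity_mono 1 (fun n C =>
      renyiDiv_nonneg_of_lt_one ha0 ha1 (hP n C) (unif_pos n) (sum_unif n)) fun n C => by
      rw [one_mul]
      exact renyiDiv_le_renyiDiv_one ha0 ha1 (hP n C) (unif_pos n)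
  have hupper : smoothingCapacity 1 (bernoulliKernel δ) ≤ ((1 - binEntropy δ : ℝ) : EReal) := by
    refine ge_of_tendsto (hlim.mono_left (nhdsGT_le_nhdsNE 1)) ?_
    filter_upwards [self_mem_nhdsWithin] with a ha
    rw [← smoothingCapacity_of_one_lt h0 h1 ha]
    refine smoothingCapacity_mono 1 (fun n C =>
      renyiDiv_one_nonneg (hP n C) (unif_pos n) (sum_unif n)) fun n C => ?_
    rw [one_mul]
    exact renyiDiv_one_le_renyiDiv ha (hP n C) (unif_pos n)
  have hlower : ∀ a : ℝ, 0 < a → a < 1 → ((1 - binEntropy δ : ℝ) : EReal) ≤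
      smoothingCapacity (ENNReal.ofReal a) (bernoulliKernel δ) := fun a ha0 ha1 => by
    refine le_of_tendsto (hlim.mono_left (nhdsLT_le_nhdsNE 1)) ?_
    -- The comparison constant blows up as `b → 1`, but each fixed `b` already gives a capacity
    -- inequality without it.
    filter_upwards [Ioo_mem_nhdsLT ha1] with b hb
    have hb0 : 0 < b := ha0.trans hb.1
    exact (le_smoothingCapacity_of_real h0 h1 hb0 hb.2.ne).trans
      (smoothingCapacity_mono (b * (1 - a) / (a * (1 - b))) (fun n C =>
        renyiDiv_nonneg_of_lt_one hb0 hb.2 (hP n C) (unif_pos n) (sum_unif n)) fun n C =>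
        renyiDiv_le_mul_renyiDiv ha0 hb.1.le hb.2 (hP n C) (unif_pos n) (sum_unif n))
  rcases hα1.eq_or_lt with rfl | hlt
  · exact le_antisymm hupper ((hlower (1 / 2) (by norm_num) (by norm_num)).trans
      (hsub _ (by norm_num) (by norm_num)))
  · obtain ⟨a, rfl⟩ : ∃ a : ℝ, α = ENNReal.ofReal a :=
      ⟨α.toReal, (ENNReal.ofReal_toReal hlt.ne_top).symm⟩
    have ha0 : 0 < a := ENNReal.ofReal_pos.1 hα0
    have ha1 : a < 1 := ENNReal.ofReal_lt_one.1 hlt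
    exact le_antisymm ((hsub a ha0 ha1).trans hupper) (hlower a ha0 ha1)

/-- For `0 < δ < 1` the kernel has full support, so even single-word codes have zero divergence of
order `0`. -/
theorem smoothingCapacity_zero (h0 : 0 < δ) (h1 : δ < 1) :
    smoothingCapacity 0 (bernoulliKernel δ) = 0 := by
  have hpos : ∀ n (C : Code n) x, 0 < noisy (bernoulliKernel δ n) (codeDist C) x :=
    fun n C x => by
      rw [noisy_codeDist]
      exact div_pos (Finset.sum_pos (fun _ _ => mul_pos (pow_pos h0 _)
        (pow_pos (sub_pos.2 h1) _)) C.2) C.card_pos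
  refine le_antisymm ((iInf₂_le (fun n => ⟨{0}, Finset.singleton_nonempty 0⟩) ?_).trans ?_) ?_
  · have : ∀ n (C : Code n),
        renyiDiv 0 (noisy (bernoulliKernel δ n) (codeDist C)) (unif n) = 0 := fun n C => by
      simp only [renyiDiv, if_true, hpos n C, Finset.filter_true, sum_unif, Real.logb_one, neg_zero]
    simp only [PerfectlySmoothable, this]
    exact tendsto_const_nhds
  · simp [rate]
  · refine le_iInf₂ fun C _ => Filter.le_liminf_of_le (by isBoundedDefault)
      (Filter.Eventually.of_forall fun n => ?_)
    have : 0 ≤ rate (C n) := div_nonneg (Real.logb_nonneg (by norm_num)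
      (by exact_mod_cast (C n).2.card_pos)) n.cast_nonneg
    exact_mod_cast this

theorem binRenyiEntropy_ofReal {a : ℝ} (ha : 1 < a) (δ : ℝ) :
    binRenyiEntropy (ENNReal.ofReal a) δ = 1 / (1 - a) * Real.logb 2 (powSum a δ) := by
  have e0 : ENNReal.ofReal a ≠ 0 := by simpa using by linarith
  have e1 : ENNReal.ofReal a ≠ 1 := by simpa using ha.ne'
  simp only [binRenyiEntropy, renyiEntropy, e0, e1, ENNReal.ofReal_ne_top, if_false,
    ENNReal.toReal_ofReal (zero_le_one.trans ha.le), Fin.sum_univ_two, powSum,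
    Matrix.cons_val_zero, Matrix.cons_val_one]

theorem binRenyiEntropy_top (δ : ℝ) :
    binRenyiEntropy ∞ δ = -Real.logb 2 (max δ (1 - δ)) := by
  have : (⨆ i, ![δ, 1 - δ] i) = max δ (1 - δ) := by
    refine le_antisymm (ciSup_le fun i => by fin_cases i <;> simp) (max_le ?_ ?_)
    · exact le_ciSup (f := ![δ, 1 - δ]) (Set.finite_range _).bddAbove 0
    · exact le_ciSup (f := ![δ, 1 - δ]) (Set.finite_range _).bddAbove 1
  simp [binRenyiEntropy, renyiEntropy, this]

end Capacity

end Smoothing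

theorem mainTheorem2 (δ : ℝ) (hδ0 : 0 ≤ δ) (hδ1 : δ ≤ 1) :
    (0 < δ → δ < 1 →
      Smoothing.smoothingCapacity 0 (Smoothing.bernoulliKernel δ) = 0) ∧
    (∀ α : ℝ≥0∞, 0 < α → α ≤ 1 →
      Smoothing.smoothingCapacity α (Smoothing.bernoulliKernel δ) =
        ((1 - Smoothing.binEntropy δ : ℝ) : EReal)) ∧
    (∀ α : ℝ≥0∞, 1 < α →
      Smoothing.smoothingCapacity α (Smoothing.bernoulliKernel δ) =
        ((1 - Smoothing.binRenyiEntropy α δ : ℝ) : EReal)) := by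
  refine ⟨Smoothing.smoothingCapacity_zero, fun α h0 h1 =>
    Smoothing.smoothingCapacity_of_le_one hδ0 hδ1 h0 h1, fun α hα => ?_⟩
  by_cases ht : α = ∞
  · subst ht
    rw [Smoothing.smoothingCapacity_top hδ0 hδ1, Smoothing.binRenyiEntropy_top, sub_neg_eq_add]
  · obtain ⟨a, rfl⟩ : ∃ a : ℝ, α = ENNReal.ofReal a :=
      ⟨α.toReal, (ENNReal.ofReal_toReal ht).symm⟩
    have ha : 1 < a := by simpa using hα
    rw [Smoothing.smoothingCapacity_of_one_lt hδ0 hδ1 ha, Smoothing.binRenyiEntropy_ofReal ha]
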